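/- Let $k:\mathbb{R}^d\times\mathbb{R}^d\to\mathbb{R}$ be a symmetric positive definite kernel (all finite Gram matrices are symmetric and positive semidefinite), with reproducing kernel Hilbert space $H$. For a finite sequence $\mathbf{x}=(\mathbf{x}_1,\dots,\mathbf{x}_{L_{\mathbf{x}}})$ in $\mathbb{R}^d$, $L_{\mathbf{x}}\ge 1$, let $k_{\mathbf{x}}:[0,L_{\mathbf{x}}-1]\to H$ be the piecewise linear path with vertices $k(\mathbf{x}_1,\cdot),\dots,k(\mathbf{x}_{L_{\mathbf{x}}},\cdot)$, that is, $k_{\mathbf{x}}(t)=(i-t)\,k(\mathbf{x}_{i},\cdot)+(t-i+1)\,k(\mathbf{x}_{i+1},\cdot)$ for $t\in[i-1,i]$ and $1\le i<L_{\mathbf{x}}$. For $M\in\mathbb{N}=\{0,1,2,\dots\}$ let $$\mathrm{Sig}_{:M}(k_{\mathbf{x}})=\Bigl(1,\int dk_{\mathbf{x}},\dots,\int dk_{\mathbf{x}}^{\otimes M},0,0,\dots\Bigr)\in\prod_{m\ge 0}H^{\otimes m},\qquad \int dk_{\mathbf{x}}^{\otimes m}=\int_{0<t_1<\cdots<t_m<L_{\mathbf{x}}-1}dk_{\mathbf{x}}(t_1)\otimes\cdots\otimes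 dk_{\mathbf{x}}(t_m),$$ where $H^{\otimes m}$ is the Hilbert space tensor power ($H^{\otimes 0}=\mathbb{R}$), and let $$k_{\mathsf{Sig},:M}(\mathbf{x},\mathbf{y})=\langle \mathrm{Sig}_{:M}(k_{\mathbf{x}}),\mathrm{Sig}_{:M}(k_{\mathbf{y}})\rangle=\sum_{m=0}^{M}\Bigl\langle \int dk_{\mathbf{x}}^{\otimes m},\int dk_{\mathbf{y}}^{\otimes m}\Bigr\rangle_{H^{\otimes m}}.$$ Theorem. There are a single algorithm and an absolute constant $C$ such that for all $d$, all such kernels $k$, all $M\in\mathbb{N}$ and all sequences $\mathbf{x}$, $\mathbf{y}$ in $\mathbb{R}^d$ of lengths $L_{\mathbf{x}},L_{\mathbf{y}}\ge 1$, the algorithm, given $M$, $L_{\mathbf{x}}$, $L_{\mathbf{y}}$ and access to the Gram entries $k(\mathbf{x}_i,\mathbf{y}_j)$, returns exactly $k_{\mathsf{Sig},:M}(\mathbf{x},\mathbf{y})$ after at most $C\max(M,1)^3L^2$ steps, where $L=\max(L_{\mathbf{x}},L_{\mathbf{y}})$. Here an algorithm is a program with exact real arithmetic at unit cost: reading a Gram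 entry, an access to a variable or an array entry, an addition, subtraction or multiplication of reals, a division of a real by a natural number, an addition, subtraction or comparison of indices, an assignment and a loop iteration each count as a step. -/

import Mathlib

open scoped TensorProduct

/-! ### Kernels and their reproducing kernel Hilbert spaces -/

/-- A (symmetric, positive definite) kernel on `X`: every finite Gram matrix is symmetric and
positive semidefinite. -/
def IsPosDefKernel {X : Type} (k : X → X → ℝ) : Prop :=
  (∀ x y, k x y = k y x) ∧
    ∀ (n : ℕ) (x : Fin n → X) (c : Fin n → ℝ), 0 ≤ ∑ i, ∑ j, c i * c j * k (x i) (x j)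

/-- The kernel `k` as a matrix of operators on `ℝ`, the form in which Mathlib's `RKHS.OfKernel`
expects it. -/
noncomputable def kernelMatrix {X : Type} (k : X → X → ℝ) : Matrix X X (ℝ →L[ℝ] ℝ) :=
  Matrix.of fun x y => k x y • ContinuousLinearMap.id ℝ ℝ

theorem IsPosDefKernel.posSemidef {X : Type} {k : X → X → ℝ} (hk : IsPosDefKernel k) :
    (kernelMatrix k).PosSemidef := by
  have key := (RKHS.posSemidef_tfae (K := kernelMatrix k)).out 0 2
  refine key.mpr ⟨?_, fun f => ?_⟩
  · ext x y
    have h1 : ContinuousLinearMap.adjoint (ContinuousLinearMap.id ℝ ℝ) =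
        ContinuousLinearMap.id ℝ ℝ := star_one (ℝ →L[ℝ] ℝ)
    simp [kernelMatrix, Matrix.conjTranspose_apply, ContinuousLinearMap.star_eq_adjoint, h1,
      hk.1 x y]
  · have h := hk.2 f.support.card (fun i => (f.support.equivFin.symm i : X))
      (fun i => f (f.support.equivFin.symm i : X))
    have e : ∀ g : X → ℝ, ∑ i : Fin f.support.card, g (f.support.equivFin.symm i : X) =
        ∑ x ∈ f.support, g x := fun g => by
      rw [← Finset.sum_coe_sort f.support g]
      exact Equiv.sum_comp f.support.equivFin.symm (fun z : f.support => g z)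
    have h' : 0 ≤ ∑ x ∈ f.support, ∑ y ∈ f.support, f x * f y * k x y := by
      rw [← e]
      refine h.trans_eq (Finset.sum_congr rfl fun i _ => ?_)
      exact e (fun y => f (f.support.equivFin.symm i : X) * f y * k (f.support.equivFin.symm i) y)
    refine h'.trans_eq ?_
    simp only [Finsupp.sum, kernelMatrix, RCLike.re_to_real]
    refine Finset.sum_congr rfl fun x _ => Finset.sum_congr rfl fun y _ => ?_
    simp [hk.1 x y]
    ring

/-- The canonical feature `k(x, ·)`, an element of the reproducing kernel Hilbert space of `k`. -/
noncomputable def kernelFeature {X : Type} (k : X → X → ℝ) [Fact (kernelMatrix k).PosSemidef]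
    (x : X) : RKHS.OfKernel (kernelMatrix k) :=
  RKHS.kerFun (RKHS.OfKernel (kernelMatrix k)) x 1

/-! ### Hilbert tensor powers -/

/-- A bundled real Hilbert space. -/
structure RealHilbert where
  carrier : Type
  [grp : NormedAddCommGroup carrier]
  [inn : InnerProductSpace ℝ carrier]
  [compl : CompleteSpace carrier]

attribute [instance] RealHilbert.grp RealHilbert.inn RealHilbert.compl

section Signature

variable (H : Type) [NormedAddCommGroup H] [InnerProductSpace ℝ H]

/-- The Hilbert space `H^{⊗m}`: `H^{⊗0} = ℝ`, and `H^{⊗(m+1)}` is the completion of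
`H^{⊗m} ⊗ H` for the inner product with `⟪a ⊗ u, b ⊗ v⟫ = ⟪a, b⟫ * ⟪u, v⟫`. -/
noncomputable def tensorPow : ℕ → RealHilbert
  | 0 => { carrier := ℝ }
  | m + 1 => { carrier := UniformSpace.Completion ((tensorPow m).carrier ⊗[ℝ] H) }

variable {H}

/-- The product `a ⊗ u` in `H^{⊗(m+1)}` of `a` in `H^{⊗m}` and `u` in `H`. -/
noncomputable def tensorSnoc {m : ℕ} (a : (tensorPow H m).carrier) (u : H) :
    (tensorPow H (m + 1)).carrier :=
  ((a ⊗ₜ[ℝ] u : (tensorPow H m).carrier ⊗[ℝ] H) :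
    UniformSpace.Completion ((tensorPow H m).carrier ⊗[ℝ] H))

/-! ### Signatures -/

/-- The iterated integral `∫_{0 < t₁ < ⋯ < t_m < t} γ'(t₁) ⊗ ⋯ ⊗ γ'(t_m) dt₁ ⋯ dt_m` of an
(absolutely continuous) path `γ`. -/
noncomputable def iteratedIntegral (γ : ℝ → H) : (m : ℕ) → ℝ → (tensorPow H m).carrier
  | 0, _ => (1 : ℝ)
  | m + 1, t => ∫ s in (0 : ℝ)..t, tensorSnoc (iteratedIntegral γ m s) (deriv γ s)

/-- The signature of `γ` on `[0, T]` truncated at level `M`, as a sequence of tensors which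
vanishes beyond degree `M`. -/
noncomputable def truncSignature (M : ℕ) (T : ℝ) (γ : ℝ → H) (m : ℕ) : (tensorPow H m).carrier :=
  if m ≤ M then iteratedIntegral γ m T else 0

/-- The inner product of two sequences of tensors. -/
noncomputable def tensorInner (a b : (m : ℕ) → (tensorPow H m).carrier) : ℝ :=
  ∑' m, inner ℝ (a m) (b m)

/-- The piecewise linear path through the points `v 0, …, v (L - 1)`: for `i + 1 < L` and `t` in
`[i, i + 1]` it is at `(1 - (t - i)) v i + (t - i) v (i + 1)`. It is used on `[0, L - 1]` only. -/
noncomputable def piecewiseLinear {L : ℕ} (v : Fin L → H) (t : ℝ) : H :=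
  let w : ℕ → H := fun i => if h : i < L then v ⟨i, h⟩ else 0
  (1 - (t - ⌊t⌋₊)) • w ⌊t⌋₊ + (t - ⌊t⌋₊) • w (⌊t⌋₊ + 1)

end Signature

/-- The signature kernel truncated at level `M` of the sequences `x` and `y`: the inner product of
the truncated signatures of the piecewise linear paths through the features `k(x_i, ·)` and
`k(y_j, ·)` in the reproducing kernel Hilbert space of `k`. -/
noncomputable def truncSigKernel {X : Type} (k : X → X → ℝ) (hk : IsPosDefKernel k) (M : ℕ)
    {Lx Ly : ℕ} (x : Fin Lx → X) (y : Fin Ly → X) : ℝ :=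
  haveI : Fact (kernelMatrix k).PosSemidef := ⟨hk.posSemidef⟩
  tensorInner
    (truncSignature M ((Lx : ℝ) - 1) (piecewiseLinear fun i => kernelFeature k (x i)))
    (truncSignature M ((Ly : ℝ) - 1) (piecewiseLinear fun j => kernelFeature k (y j)))

/-! ### A model of exact computation with unit costs

Programs are written in a small imperative language with natural number variables, arrays of real
numbers, and counting loops. Every literal, variable access, array access, arithmetic operation,
assignment, test and loop iteration is a step. The only access to the data is by reading single
entries of a matrix `G` of real numbers. -/

namespace RealProgram

/-- Memory: natural number variables, and real arrays `cells a` addressed by tuples of indices. -/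
structure Store where
  vars : ℕ → ℕ
  cells : ℕ → List ℕ → ℝ

/-- Index expressions; subtraction is truncated. -/
inductive NatExpr where
  | lit (n : ℕ)
  | var (v : ℕ)
  | add (e f : NatExpr)
  | sub (e f : NatExpr)

/-- Real expressions. The only division is that by a natural number. -/
inductive RealExpr where
  | ofNat (e : NatExpr)
  | cell (a : ℕ) (idx : List NatExpr)
  | entry (i j : NatExpr)
  | add (p q : RealExpr)
  | sub (p q : RealExpr)
  | mul (p q : RealExpr)
  | div (p : RealExpr) (e : NatExpr)

/-- Programs. `loop v e c` executes `c` for `v = 0, 1, …, n - 1`, where `n` is the value of `e` on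
entry to the loop; `ifLt e f c c'` executes `c` if `e < f` and `c'` otherwise. -/
inductive Program where
  | skip
  | setVar (v : ℕ) (e : NatExpr)
  | setCell (a : ℕ) (idx : List NatExpr) (p : RealExpr)
  | seq (c c' : Program)
  | ifLt (e f : NatExpr) (c c' : Program)
  | loop (v : ℕ) (e : NatExpr) (c : Program)

def NatExpr.eval (s : Store) : NatExpr → ℕ
  | lit n => n
  | var v => s.vars v
  | add e f => e.eval s + f.eval s
  | sub e f => e.eval s - f.eval s

def NatExpr.cost : NatExpr → ℕ
  | lit _ => 1
  | var _ => 1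
  | add e f => e.cost + f.cost + 1
  | sub e f => e.cost + f.cost + 1

noncomputable def RealExpr.eval (G : ℕ → ℕ → ℝ) (s : Store) : RealExpr → ℝ
  | ofNat e => (e.eval s : ℝ)
  | cell a idx => s.cells a (idx.map (NatExpr.eval s))
  | entry i j => G (i.eval s) (j.eval s)
  | add p q => p.eval G s + q.eval G s
  | sub p q => p.eval G s - q.eval G s
  | mul p q => p.eval G s * q.eval G s
  | div p e => p.eval G s / (e.eval s : ℝ)

def RealExpr.cost : RealExpr → ℕ
  | ofNat e => e.cost + 1
  | cell _ idx => (idx.map NatExpr.cost).sum + 1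
  | entry i j => i.cost + j.cost + 1
  | add p q => p.cost + q.cost + 1
  | sub p q => p.cost + q.cost + 1
  | mul p q => p.cost + q.cost + 1
  | div p e => p.cost + e.cost + 1

/-- Assign `n` to the variable `v`. -/
def Store.setVar (s : Store) (v n : ℕ) : Store :=
  { s with vars := Function.update s.vars v n }

/-- Assign `r` to the entry with indices `idx` of the array `a`. -/
def Store.setCell (s : Store) (a : ℕ) (idx : List ℕ) (r : ℝ) : Store :=
  { s with cells := Function.update s.cells a (Function.update (s.cells a) idx r) }

/-- Execution of a program from a given store: the resulting store and the number of steps. -/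
noncomputable def Program.exec (G : ℕ → ℕ → ℝ) : Program → Store → Store × ℕ
  | skip, s => (s, 1)
  | setVar v e, s => (s.setVar v (e.eval s), e.cost + 1)
  | setCell a idx p, s =>
      (s.setCell a (idx.map (NatExpr.eval s)) (p.eval G s),
        (idx.map NatExpr.cost).sum + p.cost + 1)
  | seq c c', s =>
      let r := c.exec G s
      let r' := c'.exec G r.1
      (r'.1, r.2 + r'.2)
  | ifLt e f c c', s =>
      let r := if e.eval s < f.eval s then c.exec G s else c'.exec G s
      (r.1, e.cost + f.cost + 1 + r.2)
  | loop v e c, s =>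
      (List.range (e.eval s)).foldl
        (fun r i =>
          let r' := c.exec G (r.1.setVar v i)
          (r'.1, r.2 + 1 + r'.2))
        (s, e.cost + 1)

/-- The initial store: the variables `0`, `1`, `2` hold the truncation level and the lengths of the
two sequences, and everything else is zero. -/
def initStore (M Lx Ly : ℕ) : Store where
  vars v := if v = 0 then M else if v = 1 then Lx else if v = 2 then Ly else 0
  cells _ _ := 0

/-- A real `Lx × Ly` matrix as the data of a program; entries out of range read as zero. -/
def matrixData {Lx Ly : ℕ} (G : Fin Lx → Fin Ly → ℝ) (i j : ℕ) : ℝ :=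
  if h : i < Lx ∧ j < Ly then G ⟨i, h.1⟩ ⟨j, h.2⟩ else 0

/-- The output of a program on truncation level `M` and matrix `G`: the content of the array `0` at
the empty tuple of indices after execution. -/
noncomputable def Program.output (P : Program) (M : ℕ) {Lx Ly : ℕ} (G : Fin Lx → Fin Ly → ℝ) : ℝ :=
  (P.exec (matrixData G) (initStore M Lx Ly)).1.cells 0 []

/-- The number of steps of a program on truncation level `M` and matrix `G`. -/
noncomputable def Program.steps (P : Program) (M : ℕ) {Lx Ly : ℕ} (G : Fin Lx → Fin Ly → ℝ) : ℕ :=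
  (P.exec (matrixData G) (initStore M Lx Ly)).2

end RealProgram

/-! Write `S_i`, `T_j` for the signatures of the two paths up to the vertices `i`, `j`, and `u_i`,
`v_j` for the increments of the segments that start there. On a segment the derivative is constant,
so Chen's relation reads `S_{i+1} = S_i ⊗ exp(u_i)`, that is, `S_{i+1}^m = ∑_p S_i^{m-p} ⊗ u_i^{⊗p}
/ p!` (`iteratedIntegral_natCast_succ`).

Consider all inner products `f m p q i j = ⟪S_i^{m-p} ⊗ u_i^{⊗p} / p!, T_j^{m-q} ⊗ v_j^{⊗q} / q!⟫`.
If `p, q ≥ 1`, both tensors end in an increment; splitting it off leaves `⟪u_i, v_j⟫ / (p q)` times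
the entry for `m-1, p-1, q-1`. If `p = 0`, Chen's relation gives the entry as a sum over `p` of
entries at `i-1`; likewise for `q = 0` and `j-1` (`isSigTable_inner`). By the reproducing property,
`⟪u_i, v_j⟫` is a mixed second difference of Gram entries, so the recurrences involve only
accessible data (`exists_isSigTable_truncSigKernel`).

There are `(M+1)^3 Lx Ly` entries. Running sums over `p` and over `q` are stored beside the table,
so that each entry costs boundedly many steps even where its recurrence is a sum. Correctness is a
loop invariant along the lexicographic order of `(i, j, m, p, q)` (`Filled.exec_body`); the cost
bound is propagated through the nested loops with it. -/

/-! ### Iterated integrals of paths with piecewise constant derivative -/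

section Signature

open MeasureTheory

variable {H : Type} [NormedAddCommGroup H] [InnerProductSpace ℝ H]

/-- `tensorSnoc` as a linear map in its first argument. -/
noncomputable def tensorSnocLeft (m : ℕ) (u : H) :
    (tensorPow H m).carrier →ₗ[ℝ] (tensorPow H (m + 1)).carrier :=
  (UniformSpace.Completion.toComplₗᵢ (𝕜 := ℝ)
    (E := (tensorPow H m).carrier ⊗[ℝ] H)).toLinearMap ∘ₗ
      (TensorProduct.mk ℝ (tensorPow H m).carrier H).flip u

theorem tensorSnocLeft_apply {m : ℕ} (a : (tensorPow H m).carrier) (u : H) :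
    tensorSnocLeft m u a = tensorSnoc a u := rfl

theorem inner_tensorSnoc {m : ℕ} (a b : (tensorPow H m).carrier) (u v : H) :
    inner ℝ (tensorSnoc a u) (tensorSnoc b v) = inner ℝ a b * inner ℝ u v := by
  have h := UniformSpace.Completion.inner_coe (𝕜 := ℝ) (a ⊗ₜ[ℝ] u : (tensorPow H m).carrier ⊗[ℝ] H)
    (b ⊗ₜ[ℝ] v)
  rw [TensorProduct.inner_tmul] at h
  exact h

/-- The degree `m` part of `S ⊗ u^{⊗p} / p!`, for a sequence `S` of tensors. -/
noncomputable def tensorExpTerm (S : (m : ℕ) → (tensorPow H m).carrier) (u : H) :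
    (m p : ℕ) → (tensorPow H m).carrier
  | m, 0 => S m
  | 0, _ + 1 => 0
  | m + 1, p + 1 => ((p : ℝ) + 1)⁻¹ • tensorSnoc (tensorExpTerm S u m p) u

theorem tensorExpTerm_zero_right (S : (m : ℕ) → (tensorPow H m).carrier) (u : H) (m : ℕ) :
    tensorExpTerm S u m 0 = S m := by
  cases m <;> rfl

theorem tensorExpTerm_succ_succ (S : (m : ℕ) → (tensorPow H m).carrier) (u : H) (m p : ℕ) :
    tensorExpTerm S u (m + 1) (p + 1) =
      ((p : ℝ) + 1)⁻¹ • tensorSnoc (tensorExpTerm S u m p) u := rfl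

/-- A tensor of degree `m` has no room for more than `m` factors `u`. This allows sums over `p` to
have a length independent of `m`. -/
theorem tensorExpTerm_eq_zero (S : (m : ℕ) → (tensorPow H m).carrier) (u : H) {m p : ℕ}
    (h : m < p) : tensorExpTerm S u m p = 0 := by
  induction m generalizing p with
  | zero =>
    obtain ⟨p, rfl⟩ := Nat.exists_eq_succ_of_ne_zero h.ne'
    rfl
  | succ m ih =>
    obtain ⟨p, rfl⟩ := Nat.exists_eq_succ_of_ne_zero (Nat.ne_zero_of_lt h)
    rw [tensorExpTerm_succ_succ, ih (by omega), ← tensorSnocLeft_apply, map_zero, smul_zero]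

theorem iteratedIntegral_succ (γ : ℝ → H) (m : ℕ) (t : ℝ) :
    iteratedIntegral γ (m + 1) t =
      ∫ s in (0 : ℝ)..t, tensorSnoc (iteratedIntegral γ m s) (deriv γ s) := rfl

theorem iteratedIntegral_succ_zero (γ : ℝ → H) (m : ℕ) : iteratedIntegral γ (m + 1) 0 = 0 := by
  rw [iteratedIntegral_succ, intervalIntegral.integral_same]

/-- On an interval where the derivative is constant, iterated integrals are given by the
exponential series. -/
theorem iteratedIntegral_natCast_add {γ : ℝ → H} {δ : ℕ → H}
    (hγ : ∀ (i : ℕ), ∀ s ∈ Set.Ioo (i : ℝ) (i + 1), deriv γ s = δ i) (m i : ℕ) {a : ℝ}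
    (ha : a ∈ Set.Icc (0 : ℝ) 1) :
    iteratedIntegral γ m (i + a) = ∑ p ∈ Finset.range (m + 1),
      a ^ p • tensorExpTerm (fun n => iteratedIntegral γ n i) (δ i) m p := by
  induction m generalizing i a with
  | zero =>
    rw [Finset.sum_range_one, pow_zero, one_smul]
    rfl
  | succ m ih =>
    -- `F` is the integrand in degree `m + 1`; by the induction hypothesis it agrees with the
    -- polynomial `Q j` inside the `j`-th segment.
    set F : ℝ → (tensorPow H (m + 1)).carrier := fun s =>
      tensorSnoc (iteratedIntegral γ m s) (deriv γ s) with hF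
    set Q : ℕ → ℝ → (tensorPow H (m + 1)).carrier := fun j s =>
      ∑ p ∈ Finset.range (m + 1), (s - j) ^ p •
        tensorSnoc (tensorExpTerm (fun n => iteratedIntegral γ n j) (δ j) m p) (δ j) with hQ
    have hFQ : ∀ (j : ℕ), ∀ s ∈ Set.Ioo (j : ℝ) (j + 1), F s = Q j s := by
      intro j s hs
      have h1 := ih j (a := s - j) ⟨by linarith [hs.1], by linarith [hs.2]⟩
      rw [add_sub_cancel] at h1
      simp only [hF, hQ]
      rw [h1, hγ j s hs, ← tensorSnocLeft_apply, map_sum]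
      simp only [map_smul, tensorSnocLeft_apply]
    have hcont : ∀ j : ℕ, Continuous (Q j) := fun j => by
      simp only [hQ]
      fun_prop
    have hae : ∀ (j : ℕ) (b : ℝ), b ∈ Set.Icc (0 : ℝ) 1 →
        ∀ᵐ s, s ∈ Set.uIoc (j : ℝ) (j + b) → F s = Q j s := by
      intro j b hb
      -- For `b = 1` the half-open interval contains the vertex `j + 1`, where the derivative is not
      -- controlled; it is a null set.
      have : ∀ᵐ s : ℝ, s ≠ (j : ℝ) + 1 := by
        simp [ae_iff]
      filter_upwards [this] with s hs hs'
      rw [Set.uIoc_of_le (by linarith [hb.1])] at hs'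
      exact hFQ j s ⟨hs'.1, lt_of_le_of_ne (by linarith [hs'.2, hb.2]) hs⟩
    have hint : ∀ (j : ℕ) (b : ℝ), b ∈ Set.Icc (0 : ℝ) 1 →
        IntervalIntegrable F volume (j : ℝ) (j + b) := by
      intro j b hb
      refine ((hcont j).intervalIntegrable _ _).congr_ae ?_
      refine (ae_restrict_iff' measurableSet_uIoc).2 ?_
      filter_upwards [hae j b hb] with s hs hs'
      exact (hs hs').symm
    have hint0 : IntervalIntegrable F volume (0 : ℝ) (i : ℝ) := by
      have := IntervalIntegrable.trans_iterate (μ := volume) (f := F) (a := fun n : ℕ => (n : ℝ))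
        (n := i) (fun k _ => by
          have := hint k 1 ⟨zero_le_one, le_rfl⟩
          simpa using this)
      simpa using this
    have hval : ∫ s in (i : ℝ)..(i + a), F s = ∑ p ∈ Finset.range (m + 1),
        a ^ (p + 1) •
          tensorExpTerm (fun n => iteratedIntegral γ n i) (δ i) (m + 1) (p + 1) := by
      rw [intervalIntegral.integral_congr_ae (hae i a ha)]
      simp only [hQ]
      rw [intervalIntegral.integral_finsetSum]
      · refine Finset.sum_congr rfl fun p _ => ?_
        rw [intervalIntegral.integral_smul_const, tensorExpTerm_succ_succ, smul_smul]
        congr 1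
        rw [intervalIntegral.integral_comp_sub_right (fun x => x ^ p)]
        simp [div_eq_mul_inv]
      · intro p _
        apply Continuous.intervalIntegrable
        fun_prop
    -- The term `p = 0` is the integral up to the vertex `i`; the terms with `p ≥ 1` are the
    -- integral over the last, partial segment.
    rw [Finset.sum_range_succ', iteratedIntegral_succ,
      ← intervalIntegral.integral_add_adjacent_intervals hint0 (hint i a ha), hval,
      pow_zero, one_smul, tensorExpTerm_zero_right]
    exact add_comm _ _

theorem iteratedIntegral_natCast_succ {γ : ℝ → H} {δ : ℕ → H}
    (hγ : ∀ (i : ℕ), ∀ s ∈ Set.Ioo (i : ℝ) (i + 1), deriv γ s = δ i) {m N : ℕ} (hm : m < N)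
    (i : ℕ) :
    iteratedIntegral γ m ((i + 1 : ℕ) : ℝ) = ∑ p ∈ Finset.range N,
      tensorExpTerm (fun n => iteratedIntegral γ n i) (δ i) m p := by
  rw [Nat.cast_succ, iteratedIntegral_natCast_add hγ m i ⟨zero_le_one, le_rfl⟩]
  simp only [one_pow, one_smul]
  refine Finset.sum_subset (Finset.range_subset_range.2 hm) fun p _ hp => ?_
  exact tensorExpTerm_eq_zero _ _ (by simpa using hp)

/-- A finite sequence continued by zero. -/
def extendByZero {L : ℕ} (v : Fin L → H) (i : ℕ) : H :=
  if h : i < L then v ⟨i, h⟩ else 0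

/-- No bound on `i` is imposed: past the last point the path is continued by zeros, so the formula
holds on every segment, as the integration lemmas require. -/
theorem deriv_piecewiseLinear {L : ℕ} (v : Fin L → H) (i : ℕ) {s : ℝ}
    (hs : s ∈ Set.Ioo (i : ℝ) (i + 1)) :
    deriv (piecewiseLinear v) s = extendByZero v (i + 1) - extendByZero v i := by
  have hev : piecewiseLinear v =ᶠ[nhds s] fun t =>
      (1 - (t - i)) • extendByZero v i + (t - i) • extendByZero v (i + 1) := by
    filter_upwards [isOpen_Ioo.mem_nhds hs] with t ht
    have hfl : ⌊t⌋₊ = i := by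
      rw [Nat.floor_eq_iff (by linarith [ht.1, i.cast_nonneg (α := ℝ)])]
      exact ⟨ht.1.le, ht.2⟩
    simp only [piecewiseLinear, hfl, extendByZero]
  rw [hev.deriv_eq]
  have h1 : HasDerivAt (fun t : ℝ => t - i) 1 s := (hasDerivAt_id s).sub_const _
  have h2 := ((h1.const_sub 1).smul_const (extendByZero v i)).add
    (h1.smul_const (extendByZero v (i + 1)))
  refine h2.deriv.trans ?_
  rw [neg_smul, one_smul, one_smul, neg_add_eq_sub]

end Signature

/-! ### Recurrences for the inner products -/

/-- The recurrences, for degrees up to `M`, of the inner products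
`⟪S_i^{m-p} ⊗ u_i^{⊗p} / p!, T_j^{m-q} ⊗ v_j^{⊗q} / q!⟫` formed from two signatures `S`, `T` of
piecewise linear paths with increments `u`, `v` such that `⟪u_i, v_j⟫ = g i j`. -/
structure IsSigTable (M : ℕ) (g : ℕ → ℕ → ℝ) (f : ℕ → ℕ → ℕ → ℕ → ℕ → ℝ) : Prop where
  zero_zero (i j : ℕ) : f 0 0 0 i j = 1
  zero (p q i j : ℕ) (h : 0 < p + q) : f 0 p q i j = 0
  succ (m p q i j : ℕ) : f (m + 1) (p + 1) (q + 1) i j =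
    g i j * f m p q i j / ((p + 1 : ℕ) : ℝ) / ((q + 1 : ℕ) : ℝ)
  row_zero (m q j : ℕ) : f (m + 1) 0 q 0 j = 0
  col_zero (m p i : ℕ) : f (m + 1) p 0 i 0 = 0
  row (m q i j : ℕ) (h : m ≤ M) : f m 0 q (i + 1) j = ∑ p ∈ Finset.range (M + 1), f m p q i j
  col (m p i j : ℕ) (h : m ≤ M) : f m p 0 i (j + 1) = ∑ q ∈ Finset.range (M + 1), f m p q i j

section Signature

variable {H : Type} [NormedAddCommGroup H] [InnerProductSpace ℝ H]

/-- `row` and `col` are Chen's relation in one slot of the inner product; `succ` is the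
multiplicativity of the inner product on `a ⊗ u`. In positive degree the signature at time `0`
vanishes, which gives `row_zero` and `col_zero`. -/
theorem isSigTable_inner {γ η : ℝ → H} {δ ε : ℕ → H}
    (hγ : ∀ (i : ℕ), ∀ s ∈ Set.Ioo (i : ℝ) (i + 1), deriv γ s = δ i)
    (hη : ∀ (i : ℕ), ∀ s ∈ Set.Ioo (i : ℝ) (i + 1), deriv η s = ε i) (M : ℕ) :
    IsSigTable M (fun i j => inner ℝ (δ i) (ε j)) fun m p q i j =>
      inner ℝ (tensorExpTerm (fun n => iteratedIntegral γ n i) (δ i) m p)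
        (tensorExpTerm (fun n => iteratedIntegral η n j) (ε j) m q) where
  zero_zero i j := by
    have h : inner ℝ (1 : ℝ) (1 : ℝ) = 1 := by simp
    exact h
  zero p q i j h := by
    rcases Nat.eq_zero_or_pos p with rfl | hp
    · rw [tensorExpTerm_eq_zero _ _ (by omega : 0 < q), inner_zero_right]
    · rw [tensorExpTerm_eq_zero _ _ hp, inner_zero_left]
  succ m p q i j := by
    rw [tensorExpTerm_succ_succ, tensorExpTerm_succ_succ, real_inner_smul_left,
      real_inner_smul_right, inner_tensorSnoc]
    push_cast
    ring
  row_zero m q j := by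
    rw [tensorExpTerm_zero_right, Nat.cast_zero, iteratedIntegral_succ_zero, inner_zero_left]
  col_zero m q j := by
    rw [tensorExpTerm_zero_right, Nat.cast_zero, iteratedIntegral_succ_zero, inner_zero_right]
  row m q i j h := by
    rw [tensorExpTerm_zero_right, iteratedIntegral_natCast_succ hγ (Nat.lt_succ_of_le h), sum_inner]
  col m p i j h := by
    rw [tensorExpTerm_zero_right, iteratedIntegral_natCast_succ hη (Nat.lt_succ_of_le h), inner_sum]

theorem tensorInner_truncSignature (M : ℕ) (S T : ℝ) (γ η : ℝ → H) :
    tensorInner (truncSignature M S γ) (truncSignature M T η) =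
      ∑ m ∈ Finset.range (M + 1), inner ℝ (iteratedIntegral γ m S) (iteratedIntegral η m T) := by
  rw [tensorInner, tsum_eq_sum (s := Finset.range (M + 1))]
  · refine Finset.sum_congr rfl fun m hm => ?_
    have hm : m ≤ M := by simpa [Nat.lt_succ_iff] using hm
    simp only [truncSignature, if_pos hm]
  · intro m hm
    have hm : ¬ m ≤ M := by simpa [Nat.lt_succ_iff] using hm
    simp only [truncSignature, if_neg hm, inner_zero_left]

end Signature

/-! ### Reduction to the Gram matrix -/

theorem inner_kernelFeature {X : Type} (k : X → X → ℝ) [Fact (kernelMatrix k).PosSemidef]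
    (x y : X) :
    inner ℝ (kernelFeature k x) (kernelFeature k y) = k x y := by
  rw [kernelFeature, kernelFeature, RKHS.kerFun_inner, RKHS.kerFun_apply,
    RKHS.OfKernel.kernel_ofKernel]
  simp [kernelMatrix]

/-- The mixed second difference of a matrix. -/
def mixedDiff (G : ℕ → ℕ → ℝ) (i j : ℕ) : ℝ :=
  G (i + 1) (j + 1) - G (i + 1) j - G i (j + 1) + G i j

/-- The truncated signature kernel is read off from a table with the recurrences of `IsSigTable`. -/
theorem exists_isSigTable_truncSigKernel {X : Type} (k : X → X → ℝ) (hk : IsPosDefKernel k)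
    (M : ℕ) {Lx Ly : ℕ} (hx : 1 ≤ Lx) (hy : 1 ≤ Ly) (x : Fin Lx → X) (y : Fin Ly → X) :
    ∃ f, IsSigTable M (mixedDiff (RealProgram.matrixData fun i j => k (x i) (y j))) f ∧
      truncSigKernel k hk M x y = ∑ m ∈ Finset.range (M + 1), f m 0 0 (Lx - 1) (Ly - 1) := by
  have : Fact (kernelMatrix k).PosSemidef := ⟨hk.posSemidef⟩
  have h := isSigTable_inner
    (fun i s hs => deriv_piecewiseLinear (fun i => kernelFeature k (x i)) i hs)
    (fun i s hs => deriv_piecewiseLinear (fun i => kernelFeature k (y i)) i hs) M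
  refine ⟨_, cast (congrArg (IsSigTable M · _) ?_) h, ?_⟩
  · symm
    funext i j
    -- Features and matrix entries are both continued by zero, so the identity persists out of
    -- range, where the program also reads.
    have key : ∀ i j, inner ℝ (extendByZero (fun i => kernelFeature k (x i)) i)
        (extendByZero (fun j => kernelFeature k (y j)) j) =
        RealProgram.matrixData (fun i j => k (x i) (y j)) i j := by
      intro i j
      simp only [extendByZero, RealProgram.matrixData]
      by_cases hi : i < Lx <;> by_cases hj : j < Ly <;>
        simp [hi, hj, inner_kernelFeature k]
    simp only [inner_sub_left, inner_sub_right, key, mixedDiff]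
    ring
  · simp only [tensorExpTerm_zero_right]
    rw [truncSigKernel, tensorInner_truncSignature, Nat.cast_sub hx, Nat.cast_sub hy, Nat.cast_one]

namespace RealProgram

/-! ### Reasoning about loops -/

theorem Program.exec_seq_fst (G : ℕ → ℕ → ℝ) (c c' : Program) (s : Store) :
    ((seq c c').exec G s).1 = (c'.exec G (c.exec G s).1).1 := rfl

theorem Program.exec_seq_snd (G : ℕ → ℕ → ℝ) (c c' : Program) (s : Store) :
    ((seq c c').exec G s).2 = (c.exec G s).2 + (c'.exec G (c.exec G s).1).2 := rfl

/-- The invariant `Inv i` describes the store after `i` iterations. Since `hstep` covers every store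
satisfying it, correctness and the uniform cost bound `B` are obtained in one induction. -/
theorem Program.exec_loop {G : ℕ → ℕ → ℝ} {v : ℕ} {e : NatExpr} {c : Program} {s : Store}
    (Inv : ℕ → Store → Prop) {B n : ℕ} (hn : e.eval s = n) (h0 : Inv 0 s)
    (hstep : ∀ i < n, ∀ t, Inv i t →
      Inv (i + 1) (c.exec G (t.setVar v i)).1 ∧ (c.exec G (t.setVar v i)).2 ≤ B) :
    Inv n ((loop v e c).exec G s).1 ∧
      ((loop v e c).exec G s).2 ≤ e.cost + 1 + n * (B + 1) := by
  simp only [Program.exec, hn]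
  clear hn
  induction n with
  | zero => exact ⟨h0, by simp⟩
  | succ n ih =>
    obtain ⟨h1, h2⟩ := ih fun i hi => hstep i (hi.trans n.lt_succ_self)
    obtain ⟨h3, h4⟩ := hstep n n.lt_succ_self _ h1
    rw [List.range_succ, List.foldl_append]
    refine ⟨h3, ?_⟩
    simp only [List.foldl_cons, List.foldl_nil]
    linarith [add_mul n 1 (B + 1)]

/-- The cost of a loop with at most `a * N` iterations, each of cost at most `b * X`. -/
theorem loop_cost_le {e n a N b X : ℕ} (hn : n ≤ a * N) (hN : 1 ≤ N) (hX : 1 ≤ X) :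
    e + n * (b * X + 1) ≤ (e + a * (b + 1)) * (N * X) := by
  have h1 : e * 1 ≤ e * (N * X) := Nat.mul_le_mul_left _ (Nat.mul_pos hN hX)
  have h2 : n * (b * X + 1) ≤ (a * N) * ((b + 1) * X) :=
    Nat.mul_le_mul hn (by linarith [add_mul b 1 X])
  linarith [show (e + a * (b + 1)) * (N * X) = e * (N * X) + (a * N) * ((b + 1) * X) by ring]

/-! ### The program

The variables `3, …, 7` hold `i`, `j`, `m`, `p`, `q`. The array `1` holds the table, the arrays `2`
and `3` its partial sums over `p` and over `q`. -/

/-- The program for the entry with indices `m`, `p`, `q`, `i`, `j` of the table. -/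
def coeffProgram : Program :=
  let idx : List NatExpr := [.var 5, .var 6, .var 7, .var 3, .var 4]
  .ifLt (.var 5) (.lit 1)
    (.ifLt (.add (.var 6) (.var 7)) (.lit 1)
      (.setCell 1 idx (.ofNat (.lit 1)))
      (.setCell 1 idx (.ofNat (.lit 0))))
    (.ifLt (.var 6) (.lit 1)
      (.ifLt (.var 3) (.lit 1)
        (.setCell 1 idx (.ofNat (.lit 0)))
        (.setCell 1 idx (.cell 2
          [.var 5, .add (.var 0) (.lit 1), .var 7, .sub (.var 3) (.lit 1), .var 4])))
      (.ifLt (.var 7) (.lit 1)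
        (.ifLt (.var 4) (.lit 1)
          (.setCell 1 idx (.ofNat (.lit 0)))
          (.setCell 1 idx (.cell 3
            [.var 5, .var 6, .add (.var 0) (.lit 1), .var 3, .sub (.var 4) (.lit 1)])))
        (.setCell 1 idx
          (.div (.div (.mul
            (.add (.sub (.sub
                (.entry (.add (.var 3) (.lit 1)) (.add (.var 4) (.lit 1)))
                (.entry (.add (.var 3) (.lit 1)) (.var 4)))
                (.entry (.var 3) (.add (.var 4) (.lit 1))))
              (.entry (.var 3) (.var 4)))
            (.cell 1 [.sub (.var 5) (.lit 1), .sub (.var 6) (.lit 1), .sub (.var 7) (.lit 1),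
              .var 3, .var 4]))
            (.var 6)) (.var 7)))))

/-- Add the current entry of the table to the partial sums. -/
def partialSumProgram : Program :=
  .seq
    (.setCell 2 [.var 5, .add (.var 6) (.lit 1), .var 7, .var 3, .var 4]
      (.add (.cell 2 [.var 5, .var 6, .var 7, .var 3, .var 4])
        (.cell 1 [.var 5, .var 6, .var 7, .var 3, .var 4])))
    (.setCell 3 [.var 5, .var 6, .add (.var 7) (.lit 1), .var 3, .var 4]
      (.add (.cell 3 [.var 5, .var 6, .var 7, .var 3, .var 4])
        (.cell 1 [.var 5, .var 6, .var 7, .var 3, .var 4])))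

/-- The program for the entries of the table with given `i`, `j`, `m`, `p`. -/
def loopQ : Program :=
  .loop 7 (.add (.var 0) (.lit 1)) (.seq coeffProgram partialSumProgram)

/-- The program for the entries of the table with given `i`, `j`, `m`. -/
def loopP : Program := .loop 6 (.add (.var 0) (.lit 1)) loopQ

/-- The program for the entries of the table with given `i`, `j`. -/
def loopM : Program := .loop 5 (.add (.var 0) (.lit 1)) loopP

/-- The program for the entries of the table with given `i`. -/
def loopJ : Program := .loop 4 (.var 2) loopM

/-- The program which fills the table. -/
def tableProgram : Program := .loop 3 (.var 1) loopJ

/-- The program which sums up the result. -/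
def resultProgram : Program :=
  .loop 5 (.add (.var 0) (.lit 1)) <|
    .setCell 0 [] (.add (.cell 0 [])
      (.cell 1 [.var 5, .lit 0, .lit 0, .sub (.var 1) (.lit 1), .sub (.var 2) (.lit 1)]))

/-- The program for the truncated signature kernel. -/
def sigKernelProgram : Program := .seq tableProgram resultProgram

/-! ### Correctness -/

/-- The entries of the table computed before those with indices `i`, `j`, `m`, `p`, `q`. -/
def Before (M Ly i j m p q i₀ j₀ m₀ p₀ q₀ : ℕ) : Prop :=
  j₀ < Ly ∧ m₀ ≤ M ∧ p₀ ≤ M ∧ q₀ ≤ M ∧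
    (i₀ < i ∨ i₀ = i ∧ (j₀ < j ∨ j₀ = j ∧ (m₀ < m ∨ m₀ = m ∧ (p₀ < p ∨ p₀ = p ∧ q₀ < q))))

/-- The store holds the inputs, and the entries of the table before the given indices. -/
structure Filled (f : ℕ → ℕ → ℕ → ℕ → ℕ → ℝ) (M Lx Ly i j m p q : ℕ) (s : Store) : Prop where
  var_zero : s.vars 0 = M
  var_one : s.vars 1 = Lx
  var_two : s.vars 2 = Ly
  result : s.cells 0 [] = 0
  coeff (i₀ j₀ m₀ p₀ q₀ : ℕ) (h : Before M Ly i j m p q i₀ j₀ m₀ p₀ q₀) :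
    s.cells 1 [m₀, p₀, q₀, i₀, j₀] = f m₀ p₀ q₀ i₀ j₀
  row_zero (i₀ j₀ m₀ q₀ : ℕ) : s.cells 2 [m₀, 0, q₀, i₀, j₀] = 0
  row (i₀ j₀ m₀ p₀ q₀ : ℕ) (h : Before M Ly i j m p q i₀ j₀ m₀ p₀ q₀) :
    s.cells 2 [m₀, p₀ + 1, q₀, i₀, j₀] = ∑ r ∈ Finset.range (p₀ + 1), f m₀ r q₀ i₀ j₀
  col_zero (i₀ j₀ m₀ p₀ : ℕ) : s.cells 3 [m₀, p₀, 0, i₀, j₀] = 0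
  col (i₀ j₀ m₀ p₀ q₀ : ℕ) (h : Before M Ly i j m p q i₀ j₀ m₀ p₀ q₀) :
    s.cells 3 [m₀, p₀, q₀ + 1, i₀, j₀] = ∑ r ∈ Finset.range (q₀ + 1), f m₀ p₀ r i₀ j₀

variable {f : ℕ → ℕ → ℕ → ℕ → ℕ → ℝ} {M Lx Ly i j m p q : ℕ} {s : Store} {G : ℕ → ℕ → ℝ}

theorem Filled.setVar (h : Filled f M Lx Ly i j m p q s) {v : ℕ} (hv : 2 < v) (n : ℕ) :
    Filled f M Lx Ly i j m p q (s.setVar v n) where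
  var_zero := by simpa [Store.setVar, Function.update_apply, show 0 ≠ v by omega] using h.var_zero
  var_one := by simpa [Store.setVar, Function.update_apply, show 1 ≠ v by omega] using h.var_one
  var_two := by simpa [Store.setVar, Function.update_apply, show 2 ≠ v by omega] using h.var_two
  result := h.result
  coeff := h.coeff
  row_zero := h.row_zero
  row := h.row
  col_zero := h.col_zero
  col := h.col

theorem Filled.of_before {i₁ j₁ m₁ p₁ q₁ : ℕ} (h : Filled f M Lx Ly i j m p q s)
    (hb : ∀ i₀ j₀ m₀ p₀ q₀, Before M Ly i₁ j₁ m₁ p₁ q₁ i₀ j₀ m₀ p₀ q₀ →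
      Before M Ly i j m p q i₀ j₀ m₀ p₀ q₀) :
    Filled f M Lx Ly i₁ j₁ m₁ p₁ q₁ s where
  var_zero := h.var_zero
  var_one := h.var_one
  var_two := h.var_two
  result := h.result
  coeff _ _ _ _ _ h₀ := h.coeff _ _ _ _ _ (hb _ _ _ _ _ h₀)
  row_zero := h.row_zero
  row _ _ _ _ _ h₀ := h.row _ _ _ _ _ (hb _ _ _ _ _ h₀)
  col_zero := h.col_zero
  col _ _ _ _ _ h₀ := h.col _ _ _ _ _ (hb _ _ _ _ _ h₀)

/-- The variables `3, …, 7` hold the given indices. -/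
def AtIndex (i j m p q : ℕ) (s : Store) : Prop :=
  s.vars 3 = i ∧ s.vars 4 = j ∧ s.vars 5 = m ∧ s.vars 6 = p ∧ s.vars 7 = q

/-- Each branch of the program is one clause of `IsSigTable`, and every stored value it reads is
either earlier in the lexicographic order or a completed sum of earlier entries. -/
theorem exec_coeffProgram_fst (hf : IsSigTable M (mixedDiff G) f)
    (h : Filled f M Lx Ly i j m p q s) (hs : AtIndex i j m p q s)
    (hj : j < Ly) (hm : m ≤ M) (hp : p ≤ M) (hq : q ≤ M) :
    (coeffProgram.exec G s).1 = s.setCell 1 [m, p, q, i, j] (f m p q i j) := by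
  obtain ⟨h3, h4, h5, h6, h7⟩ := hs
  simp only [coeffProgram, Program.exec, NatExpr.eval, RealExpr.eval, List.map_cons, List.map_nil,
    h3, h4, h5, h6, h7, h.var_zero]
  rcases m with _ | m
  · by_cases hpq : p + q < 1
    · obtain ⟨rfl, rfl⟩ : p = 0 ∧ q = 0 := by omega
      simp [hf.zero_zero]
    · simp [hpq, hf.zero p q i j (by omega)]
  rcases p with _ | p
  · rcases i with _ | i
    · simp [hf.row_zero]
    -- With `p₀ = M` the running sum is the full sum over `p`; it belongs to the preceding `i`,
    -- hence is already available.
    · simp [hf.row _ _ _ _ hm, h.row i j (m + 1) M q (by unfold Before; omega)]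
  rcases q with _ | q
  · rcases j with _ | j
    · simp [hf.col_zero]
    · simp [hf.col _ _ _ _ hm, h.col i j (m + 1) (p + 1) M (by unfold Before; omega)]
  simp [hf.succ, h.coeff i j m p q (by unfold Before; omega), mixedDiff]

theorem exec_coeffProgram_snd_le : (coeffProgram.exec G s).2 ≤ 60 := by
  simp only [coeffProgram, Program.exec]
  split_ifs <;> simp [NatExpr.cost, RealExpr.cost]

theorem Filled.exec_body (hf : IsSigTable M (mixedDiff G) f)
    (h : Filled f M Lx Ly i j m p q s) (hs : AtIndex i j m p q s)
    (hj : j < Ly) (hm : m ≤ M) (hp : p ≤ M) (hq : q ≤ M) :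
    Filled f M Lx Ly i j m p (q + 1) ((Program.seq coeffProgram partialSumProgram).exec G s).1 ∧
      ((Program.seq coeffProgram partialSumProgram).exec G s).1.vars = s.vars := by
  -- Slot `p` of array `2` holds the sum over `r < p`: slot `0` is never written and keeps its
  -- initial zero.
  have hrow : s.cells 2 [m, p, q, i, j] = ∑ r ∈ Finset.range p, f m r q i j := by
    rcases p with _ | p
    · simp [h.row_zero]
    · exact h.row i j m p q (by unfold Before; omega)
  have hcol : s.cells 3 [m, p, q, i, j] = ∑ r ∈ Finset.range q, f m p r i j := by
    rcases q with _ | q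
    · simp [h.col_zero]
    · exact h.col i j m p q (by unfold Before; omega)
  rw [Program.exec_seq_fst, exec_coeffProgram_fst hf h hs hj hm hp hq]
  obtain ⟨h3, h4, h5, h6, h7⟩ := hs
  -- An entry before the successor index is the current one or an older one; in the latter case its
  -- cells differ from those just written.
  have hb : ∀ i₀ j₀ m₀ p₀ q₀, Before M Ly i j m p (q + 1) i₀ j₀ m₀ p₀ q₀ →
      (m₀ = m ∧ p₀ = p ∧ q₀ = q ∧ i₀ = i ∧ j₀ = j) ∨
      (¬ (m₀ = m ∧ p₀ = p ∧ q₀ = q ∧ i₀ = i ∧ j₀ = j) ∧ Before M Ly i j m p q i₀ j₀ m₀ p₀ q₀) := by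
    unfold Before
    intros
    omega
  simp only [partialSumProgram, Program.exec, NatExpr.eval, RealExpr.eval, List.map_cons,
    List.map_nil, Store.setCell, h3, h4, h5, h6, h7]
  refine ⟨⟨h.var_zero, h.var_one, h.var_two, ?_, ?_, ?_, ?_, ?_, ?_⟩, trivial⟩
  · simp [h.result]
  · intro i₀ j₀ m₀ p₀ q₀ h₀
    rcases hb _ _ _ _ _ h₀ with ⟨rfl, rfl, rfl, rfl, rfl⟩ | ⟨hne, h₀⟩
    · simp
    · simp [hne, h.coeff _ _ _ _ _ h₀]
  · intro i₀ j₀ m₀ q₀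
    simp [h.row_zero]
  · intro i₀ j₀ m₀ p₀ q₀ h₀
    rcases hb _ _ _ _ _ h₀ with ⟨rfl, rfl, rfl, rfl, rfl⟩ | ⟨hne, h₀⟩
    · simp [hrow, Finset.sum_range_succ]
    · simp [hne, h.row _ _ _ _ _ h₀]
  · intro i₀ j₀ m₀ q₀
    simp [h.col_zero]
  · intro i₀ j₀ m₀ p₀ q₀ h₀
    rcases hb _ _ _ _ _ h₀ with ⟨rfl, rfl, rfl, rfl, rfl⟩ | ⟨hne, h₀⟩
    · simp [hcol, Finset.sum_range_succ]
    · simp [hne, h.col _ _ _ _ _ h₀]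

theorem exec_body_snd_le :
    ((Program.seq coeffProgram partialSumProgram).exec G s).2 ≤ 120 := by
  rw [Program.exec_seq_snd]
  have h1 := exec_coeffProgram_snd_le (G := G) (s := s)
  have h2 : ∀ t, (partialSumProgram.exec G t).2 ≤ 60 := fun t => by
    simp [partialSumProgram, Program.exec, NatExpr.cost, RealExpr.cost]
  linarith [h2 (coeffProgram.exec G s).1]

/-- The bound comes from `loop_cost_le`: evaluating the range and entering the loop costs `4`, and
`M + 1 ≤ 2 * N`, so `246 = 4 + 2 * (120 + 1)`. The constants of the enclosing loops arise in the
same way, with `2 + 1 * (b + 1)` for the loops over `j` and `i`. -/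
theorem exec_loopQ (hf : IsSigTable M (mixedDiff G) f)
    (h : Filled f M Lx Ly i j m p 0 s)
    (hs : s.vars 3 = i ∧ s.vars 4 = j ∧ s.vars 5 = m ∧ s.vars 6 = p)
    (hj : j < Ly) (hm : m ≤ M) (hp : p ≤ M) {N : ℕ} (hN : 1 ≤ N) (hMN : M + 1 ≤ 2 * N) :
    (Filled f M Lx Ly i j m (p + 1) 0 (loopQ.exec G s).1 ∧
      (loopQ.exec G s).1.vars 3 = i ∧ (loopQ.exec G s).1.vars 4 = j ∧
        (loopQ.exec G s).1.vars 5 = m) ∧ (loopQ.exec G s).2 ≤ 246 * (N * 1) := by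
  have key := Program.exec_loop (G := G) (v := 7) (e := .add (.var 0) (.lit 1))
    (c := .seq coeffProgram partialSumProgram) (s := s) (n := M + 1) (B := 120 * 1)
    (fun q t => Filled f M Lx Ly i j m p q t ∧
      t.vars 3 = i ∧ t.vars 4 = j ∧ t.vars 5 = m ∧ t.vars 6 = p)
    (by simp [NatExpr.eval, h.var_zero]) ⟨h, hs⟩ (by
      rintro q hq t ⟨ht, h3, h4, h5, h6⟩
      obtain ⟨h1, h2⟩ := (ht.setVar (v := 7) (by omega) q).exec_body hf
        (by simp [AtIndex, Store.setVar, *]) hj hm hp (by omega)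
      refine ⟨⟨h1, ?_⟩, exec_body_snd_le⟩
      rw [h2]
      simp [Store.setVar, *])
  obtain ⟨⟨h1, h3, h4, h5, -⟩, h2⟩ := key
  -- Carry in the lexicographic order: as `q₀ ≤ M`, everything before `(p + 1, 0)` is before `(p, M
  -- + 1)`.
  refine ⟨⟨h1.of_before fun _ _ _ _ _ => ?_, h3, h4, h5⟩, h2.trans (loop_cost_le hMN hN le_rfl)⟩
  unfold Before
  omega

theorem exec_loopP (hf : IsSigTable M (mixedDiff G) f)
    (h : Filled f M Lx Ly i j m 0 0 s) (hs : s.vars 3 = i ∧ s.vars 4 = j ∧ s.vars 5 = m)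
    (hj : j < Ly) (hm : m ≤ M) {N : ℕ} (hN : 1 ≤ N) (hMN : M + 1 ≤ 2 * N) :
    (Filled f M Lx Ly i j (m + 1) 0 0 (loopP.exec G s).1 ∧
      (loopP.exec G s).1.vars 3 = i ∧ (loopP.exec G s).1.vars 4 = j) ∧
        (loopP.exec G s).2 ≤ 498 * (N * (N * 1)) := by
  have key := Program.exec_loop (G := G) (v := 6) (e := .add (.var 0) (.lit 1))
    (c := loopQ) (s := s) (n := M + 1) (B := 246 * (N * 1))
    (fun p t => Filled f M Lx Ly i j m p 0 t ∧ t.vars 3 = i ∧ t.vars 4 = j ∧ t.vars 5 = m)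
    (by simp [NatExpr.eval, h.var_zero]) ⟨h, hs⟩ (by
      rintro p hp t ⟨ht, h3, h4, h5⟩
      exact exec_loopQ hf (ht.setVar (v := 6) (by omega) p)
        (by simp [Store.setVar, *]) hj hm (by omega) hN hMN)
  obtain ⟨⟨h1, h3, h4, -⟩, h2⟩ := key
  refine ⟨⟨h1.of_before fun _ _ _ _ _ => ?_, h3, h4⟩,
    h2.trans (loop_cost_le hMN hN (Nat.mul_pos hN Nat.one_pos))⟩
  unfold Before
  omega

theorem exec_loopM (hf : IsSigTable M (mixedDiff G) f)
    (h : Filled f M Lx Ly i j 0 0 0 s) (hs : s.vars 3 = i ∧ s.vars 4 = j)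
    (hj : j < Ly) {N : ℕ} (hN : 1 ≤ N) (hMN : M + 1 ≤ 2 * N) :
    (Filled f M Lx Ly i (j + 1) 0 0 0 (loopM.exec G s).1 ∧ (loopM.exec G s).1.vars 3 = i) ∧
      (loopM.exec G s).2 ≤ 1002 * (N * (N * (N * 1))) := by
  have key := Program.exec_loop (G := G) (v := 5) (e := .add (.var 0) (.lit 1))
    (c := loopP) (s := s) (n := M + 1) (B := 498 * (N * (N * 1)))
    (fun m t => Filled f M Lx Ly i j m 0 0 t ∧ t.vars 3 = i ∧ t.vars 4 = j)
    (by simp [NatExpr.eval, h.var_zero]) ⟨h, hs⟩ (by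
      rintro m hm t ⟨ht, h3, h4⟩
      exact exec_loopP hf (ht.setVar (v := 5) (by omega) m)
        (by simp [Store.setVar, *]) hj (by omega) hN hMN)
  obtain ⟨⟨h1, h3, -⟩, h2⟩ := key
  refine ⟨⟨h1.of_before fun _ _ _ _ _ => ?_, h3⟩,
    h2.trans (loop_cost_le hMN hN (Nat.succ_le_of_lt (by positivity)))⟩
  unfold Before
  omega

theorem exec_loopJ (hf : IsSigTable M (mixedDiff G) f)
    (h : Filled f M Lx Ly i 0 0 0 0 s) (hs : s.vars 3 = i)
    {N L : ℕ} (hN : 1 ≤ N) (hMN : M + 1 ≤ 2 * N) (hL : 1 ≤ L) (hLy : Ly ≤ L) :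
    Filled f M Lx Ly (i + 1) 0 0 0 0 (loopJ.exec G s).1 ∧
      (loopJ.exec G s).2 ≤ 1005 * (L * (N * (N * (N * 1)))) := by
  have key := Program.exec_loop (G := G) (v := 4) (e := .var 2)
    (c := loopM) (s := s) (n := Ly) (B := 1002 * (N * (N * (N * 1))))
    (fun j t => Filled f M Lx Ly i j 0 0 0 t ∧ t.vars 3 = i)
    (by simp [NatExpr.eval, h.var_two]) ⟨h, hs⟩ (by
      rintro j hj t ⟨ht, h3⟩
      exact exec_loopM hf (ht.setVar (v := 4) (by omega) j)
        (by simp [Store.setVar, *]) hj hN hMN)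
  obtain ⟨⟨h1, -⟩, h2⟩ := key
  refine ⟨h1.of_before fun _ _ _ _ _ => ?_,
    h2.trans (loop_cost_le (a := 1) (by omega) hL (Nat.succ_le_of_lt (by positivity)))⟩
  unfold Before
  omega

theorem exec_tableProgram (hf : IsSigTable M (mixedDiff G) f)
    (h : Filled f M Lx Ly 0 0 0 0 0 s) {N L : ℕ} (hN : 1 ≤ N) (hMN : M + 1 ≤ 2 * N)
    (hL : 1 ≤ L) (hLx : Lx ≤ L) (hLy : Ly ≤ L) :
    Filled f M Lx Ly Lx 0 0 0 0 (tableProgram.exec G s).1 ∧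
      (tableProgram.exec G s).2 ≤ 1008 * (L * (L * (N * (N * (N * 1))))) := by
  have key := Program.exec_loop (G := G) (v := 3) (e := .var 1)
    (c := loopJ) (s := s) (n := Lx) (B := 1005 * (L * (N * (N * (N * 1)))))
    (fun i t => Filled f M Lx Ly i 0 0 0 0 t)
    (by simp [NatExpr.eval, h.var_one]) h (by
      intro i hi t ht
      exact exec_loopJ hf (ht.setVar (v := 3) (by omega) i)
        (by simp [Store.setVar]) hN hMN hL hLy)
  exact ⟨key.1,
    key.2.trans (loop_cost_le (a := 1) (by omega) hL (Nat.succ_le_of_lt (by positivity)))⟩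

theorem exec_resultProgram (h : Filled f M Lx Ly Lx 0 0 0 0 s) (hx : 1 ≤ Lx) (hy : 1 ≤ Ly)
    {N : ℕ} (hN : 1 ≤ N) (hMN : M + 1 ≤ 2 * N) :
    (resultProgram.exec G s).1.cells 0 [] =
        ∑ m ∈ Finset.range (M + 1), f m 0 0 (Lx - 1) (Ly - 1) ∧
      (resultProgram.exec G s).2 ≤ 32 * (N * 1) := by
  have key := Program.exec_loop (G := G) (v := 5) (e := .add (.var 0) (.lit 1))
    (c := .setCell 0 [] (.add (.cell 0 [])
      (.cell 1 [.var 5, .lit 0, .lit 0, .sub (.var 1) (.lit 1), .sub (.var 2) (.lit 1)])))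
    -- The summation leaves array `1` untouched, so the table values known for `s` stay valid
    -- throughout.
    (s := s) (n := M + 1) (B := 13 * 1)
    (fun n t => t.vars 1 = Lx ∧ t.vars 2 = Ly ∧ t.cells 1 = s.cells 1 ∧
      t.cells 0 [] = ∑ m ∈ Finset.range n, f m 0 0 (Lx - 1) (Ly - 1))
    (by simp [NatExpr.eval, h.var_zero]) ⟨h.var_one, h.var_two, rfl, by simp [h.result]⟩ (by
      rintro m hm t ⟨h1, h2, h3, h4⟩
      have hc := h.coeff (Lx - 1) (Ly - 1) m 0 0 (by unfold Before; omega)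
      refine ⟨⟨?_, ?_, ?_, ?_⟩, ?_⟩ <;>
        simp [Program.exec, NatExpr.eval, RealExpr.eval, Store.setVar, Store.setCell,
          NatExpr.cost, RealExpr.cost, Finset.sum_range_succ, *])
  exact ⟨key.1.2.2.2, key.2.trans (loop_cost_le hMN hN le_rfl)⟩

theorem filled_initStore : Filled f M Lx Ly 0 0 0 0 0 (initStore M Lx Ly) := by
  constructor <;> simp [initStore, Before]

theorem sigKernelProgram_spec {Lx Ly : ℕ} {G : Fin Lx → Fin Ly → ℝ}
    (hf : IsSigTable M (mixedDiff (matrixData G)) f) (hx : 1 ≤ Lx) (hy : 1 ≤ Ly) :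
    sigKernelProgram.output M G = ∑ m ∈ Finset.range (M + 1), f m 0 0 (Lx - 1) (Ly - 1) ∧
      sigKernelProgram.steps M G ≤ 1040 * (max M 1) ^ 3 * (max Lx Ly) ^ 2 := by
  have hN : 1 ≤ max M 1 := le_max_right _ _
  have hMN : M + 1 ≤ 2 * max M 1 := by omega
  have hL : 1 ≤ max Lx Ly := hx.trans (le_max_left _ _)
  obtain ⟨h1, h2⟩ := exec_tableProgram (G := matrixData G) hf filled_initStore hN hMN hL
    (le_max_left _ _) (le_max_right _ _)
  obtain ⟨h3, h4⟩ := exec_resultProgram (G := matrixData G) h1 hx hy hN hMN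
  refine ⟨h3, ?_⟩
  rw [Program.steps, sigKernelProgram, Program.exec_seq_snd]
  refine (Nat.add_le_add h2 h4).trans ?_
  generalize max M 1 = N at hN
  generalize max Lx Ly = L at hL
  -- The linear cost of the final summation is absorbed into the main term, so that `1040 = 1008 +
  -- 32`.
  have h5 : N * 1 ≤ N * (N ^ 2 * L ^ 2) := Nat.mul_le_mul_left _ (by
    have : 0 < N ^ 2 * L ^ 2 := by positivity
    omega)
  calc 1008 * (L * (L * (N * (N * (N * 1))))) + 32 * (N * 1)
      ≤ 1008 * (L * (L * (N * (N * (N * 1))))) + 32 * (N * (N ^ 2 * L ^ 2)) := by gcongr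
    _ = 1040 * N ^ 3 * L ^ 2 := by ring

end RealProgram

theorem mainTheorem3 :
    ∃ (P : RealProgram.Program) (C : ℕ),
      ∀ (d : ℕ) (k : EuclideanSpace ℝ (Fin d) → EuclideanSpace ℝ (Fin d) → ℝ)
        (hk : IsPosDefKernel k) (M Lx Ly : ℕ), 1 ≤ Lx → 1 ≤ Ly →
        ∀ (x : Fin Lx → EuclideanSpace ℝ (Fin d)) (y : Fin Ly → EuclideanSpace ℝ (Fin d)),
          P.output M (fun i j => k (x i) (y j)) = truncSigKernel k hk M x y ∧
          P.steps M (fun i j => k (x i) (y j)) ≤ C * (max M 1) ^ 3 * (max Lx Ly) ^ 2 := by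
  refine ⟨RealProgram.sigKernelProgram, 1040, fun d k hk M Lx Ly hx hy x y => ?_⟩
  obtain ⟨f, hf, hval⟩ := exists_isSigTable_truncSigKernel k hk M hx hy x y
  rw [hval]
  exact RealProgram.sigKernelProgram_spec hf hx hy
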